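/- Let $\mathbb K$ be a field, $d\ge 0$ an integer, $\mathcal A$ a $\mathbb K$-algebra isomorphic to the algebra of all $(d+1)\times(d+1)$ matrices over $\mathbb K$, and $V$ a simple left $\mathcal A$-module (so $\dim_{\mathbb K} V=d+1$). An element $A\in\mathcal A$ is multiplicity-free if it has $d+1$ mutually distinct eigenvalues in $\mathbb K$; if $\theta_0,\dots,\theta_d$ is an ordering of them, the primitive idempotent of $A$ associated with $\theta_i$ is $E_i=\prod_{0\le j\le d,\,j\ne i}\frac{A-\theta_j I}{\theta_i-\theta_j}$. Let $\Phi=(A;\{E_i\}_{i=0}^d;A^*;\{E_i^*\}_{i=0}^d)$ be a Leonard system in $\mathcal A$, that is: $A,A^*\in\mathcal A$ are multiplicity-free; $\{E_i\}_{i=0}^d$ (resp. $\{E^*_i\}_{i=0}^d$) is an ordering of the primitive idempotents of $A$ (resp. $A^*$); and for $0\le i,j\le d$, both $E_iA^*E_j$ and $E_i^*AE_j^*$ are zero if $|i-j|>1$ and nonzero if $|i-j|=1$. Let $\theta_i$ (resp. $\theta_i^*$) be the eigenvalue of $A$ (resp. $A^*$) associated with $E_i$ (resp. $E_i^*$). For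 $0\le i\le d$ put $$\tau_i=(\lambda-\theta_0)(\lambda-\theta_1)\cdots(\lambda-\theta_{i-1}),\qquad \eta_i=(\lambda-\theta_d)(\lambda-\theta_{d-1})\cdots(\lambda-\theta_{d-i+1}),$$ and for $1\le i\le d$ put $$\varphi_i=(\theta_0^*-\theta_i^*)\frac{\operatorname{tr}(\tau_i(A)E_0^*)}{\operatorname{tr}(\tau_{i-1}(A)E_0^*)},\qquad \phi_i=(\theta_0^*-\theta_i^*)\frac{\operatorname{tr}(\eta_i(A)E_0^*)}{\operatorname{tr}(\eta_{i-1}(A)E_0^*)},$$ where $\operatorname{tr}$ is the trace of the action on $V$ (the denominators are nonzero). The switching element of $\Phi$ is $$S=\sum_{r=0}^d\frac{\phi_d\phi_{d-1}\cdots\phi_{d-r+1}}{\varphi_1\varphi_2\cdots\varphi_r}\,E_r .$$ Let $[0],[D],[0^*],[D^*]$ be the flags on $V$ whose $i$-th components $(0\le i\le d)$ are respectively $$E_0V+\cdots+E_iV,\quad E_dV+\cdots+E_{d-i}V,\quad E_0^*V+\cdots+E_i^*V,\quad E_d^*V+\cdots+E_{d-i}^*V.$$ For $X\in\mathcal A$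 and sequences $F=\{F_i\}_{i=0}^d$, $F'=\{F_i'\}_{i=0}^d$ of subspaces of $V$, write $XF=\{XF_i\}_{i=0}^d$, and write $F\subseteq F'$ if $F_i\subseteq F'_i$ for $0\le i\le d$. Then for every nonzero $X\in\mathcal A$ the following are equivalent: (i) $X$ is a scalar multiple of $S$; (ii) $X[0]\subseteq[0]$, $X[D]\subseteq[D]$ and $X[0^*]\subseteq[D^*]$. Moreover, if (i) and (ii) hold, then equality is attained everywhere in (ii): $X[0]=[0]$, $X[D]=[D]$ and $X[0^*]=[D^*]$. -/

import Mathlib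

open Polynomial

/-- An element of a `K`-algebra (to be thought of as isomorphic to the algebra of
`(d+1) × (d+1)` matrices) is multiplicity-free if it has `d + 1` mutually distinct
eigenvalues in `K`. -/
def IsMultiplicityFree {K 𝒜 : Type*} [Field K] [Ring 𝒜] [Algebra K 𝒜] (d : ℕ) (A : 𝒜) : Prop :=
  (spectrum K A).ncard = d + 1

/-- `θ` lists every eigenvalue of `A` in `K` exactly once. -/
def IsEigenvalueOrdering {K 𝒜 : Type*} [Field K] [Ring 𝒜] [Algebra K 𝒜] {d : ℕ}
    (A : 𝒜) (θ : Fin (d + 1) → K) : Prop :=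
  Function.Injective θ ∧ Set.range θ = spectrum K A

/-- The element `∏_{j ≠ i} (A - θ_j I) / (θ_i - θ_j)`. -/
noncomputable def primitiveIdempotent {K 𝒜 : Type*} [Field K] [Ring 𝒜] [Algebra K 𝒜] {d : ℕ}
    (A : 𝒜) (θ : Fin (d + 1) → K) (i : Fin (d + 1)) : 𝒜 :=
  aeval A (∏ j ∈ Finset.univ.erase i, C (θ i - θ j)⁻¹ * (X - C (θ j)))

/-- `E` is an ordering of the primitive idempotents of `A`: for some ordering `θ` of the
eigenvalues of `A`, `E i` is the primitive idempotent of `A` associated with `θ i`. -/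
def IsPrimitiveIdempotentOrdering (K : Type*) {𝒜 : Type*} [Field K] [Ring 𝒜] [Algebra K 𝒜]
    {d : ℕ} (A : 𝒜) (E : Fin (d + 1) → 𝒜) : Prop :=
  ∃ θ : Fin (d + 1) → K, IsEigenvalueOrdering A θ ∧ ∀ i, E i = primitiveIdempotent A θ i

/-- A Leonard system `(A; {E_i}; A^*; {E^*_i})` of diameter `d` in the `K`-algebra `𝒜`. -/
structure LeonardSystem (K 𝒜 : Type*) [Field K] [Ring 𝒜] [Algebra K 𝒜] (d : ℕ) where
  A : 𝒜
  E : Fin (d + 1) → 𝒜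
  Astar : 𝒜
  Estar : Fin (d + 1) → 𝒜
  multiplicityFree_A : IsMultiplicityFree (K := K) d A
  multiplicityFree_Astar : IsMultiplicityFree (K := K) d Astar
  idempotents_E : IsPrimitiveIdempotentOrdering K A E
  idempotents_Estar : IsPrimitiveIdempotentOrdering K Astar Estar
  E_Astar_E_eq_zero : ∀ i j : Fin (d + 1), 1 < |((i : ℕ) : ℤ) - ((j : ℕ) : ℤ)| →
    E i * Astar * E j = 0
  E_Astar_E_ne_zero : ∀ i j : Fin (d + 1), |((i : ℕ) : ℤ) - ((j : ℕ) : ℤ)| = 1 →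
    E i * Astar * E j ≠ 0
  Estar_A_Estar_eq_zero : ∀ i j : Fin (d + 1), 1 < |((i : ℕ) : ℤ) - ((j : ℕ) : ℤ)| →
    Estar i * A * Estar j = 0
  Estar_A_Estar_ne_zero : ∀ i j : Fin (d + 1), |((i : ℕ) : ℤ) - ((j : ℕ) : ℤ)| = 1 →
    Estar i * A * Estar j ≠ 0

/-- The four symbols `0`, `D`, `0^*`, `D^*`. -/
inductive FlagSymbol where
  | zero
  | D
  | zeroStar
  | DStar

namespace LeonardSystem

/-- The eigenvalue sequence: `θ i` is the eigenvalue of `A` associated with `E i`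
(it is determined by `A` and `E`, as `A * E i = θ i • E i` and `E i ≠ 0`). -/
noncomputable def θ {K 𝒜 : Type*} [Field K] [Ring 𝒜] [Algebra K 𝒜] {d : ℕ}
    (Φ : LeonardSystem K 𝒜 d) : Fin (d + 1) → K :=
  Φ.idempotents_E.choose

/-- The dual eigenvalue sequence: `θstar i` is the eigenvalue of `Astar` associated with
`Estar i`. -/
noncomputable def θstar {K 𝒜 : Type*} [Field K] [Ring 𝒜] [Algebra K 𝒜] {d : ℕ}
    (Φ : LeonardSystem K 𝒜 d) : Fin (d + 1) → K :=
  Φ.idempotents_Estar.choose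

/-- `τ_n = (λ - θ_0)(λ - θ_1) ⋯ (λ - θ_{n-1})` for `0 ≤ n ≤ d`. -/
noncomputable def τ {K 𝒜 : Type*} [Field K] [Ring 𝒜] [Algebra K 𝒜] {d : ℕ}
    (Φ : LeonardSystem K 𝒜 d) (n : Fin (d + 1)) : K[X] :=
  ∏ h ∈ Finset.univ.filter (fun h : Fin (d + 1) => h < n), (X - C (Φ.θ h))

/-- `η_n = (λ - θ_d)(λ - θ_{d-1}) ⋯ (λ - θ_{d-n+1})` for `0 ≤ n ≤ d`. -/
noncomputable def η {K 𝒜 : Type*} [Field K] [Ring 𝒜] [Algebra K 𝒜] {d : ℕ}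
    (Φ : LeonardSystem K 𝒜 d) (n : Fin (d + 1)) : K[X] :=
  ∏ h ∈ Finset.univ.filter (fun h : Fin (d + 1) => h < n), (X - C (Φ.θ h.rev))

end LeonardSystem

/-- The trace of `x ∈ 𝒜`. When `𝒜` is a full matrix algebra over `K` and `V` is a simple
`𝒜`-module, this is the matrix trace of `x`. -/
noncomputable def actionTrace {K 𝒜 : Type*} [Field K] [Ring 𝒜] [Algebra K 𝒜]
    (V : Type*) [AddCommGroup V] [Module K V] [Module 𝒜 V] [IsScalarTower K 𝒜 V] (x : 𝒜) : K :=
  LinearMap.trace K V (Algebra.lsmul K K V x)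

namespace LeonardSystem

/-- The first split sequence `φ_1, …, φ_d` (written `\varphi`), with indices shifted to start
at `0`: `firstSplit V i` is `\varphi_{i+1}`, that is,
`(θ^*_0 - θ^*_{i+1}) tr(τ_{i+1}(A) E^*_0) / tr(τ_i(A) E^*_0)`. -/
noncomputable def firstSplit {K 𝒜 : Type*} [Field K] [Ring 𝒜] [Algebra K 𝒜] {d : ℕ}
    (Φ : LeonardSystem K 𝒜 d)
    (V : Type*) [AddCommGroup V] [Module K V] [Module 𝒜 V] [IsScalarTower K 𝒜 V]
    (i : Fin d) : K :=
  (Φ.θstar 0 - Φ.θstar i.succ) *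
    (actionTrace V (aeval Φ.A (Φ.τ i.succ) * Φ.Estar 0) /
      actionTrace V (aeval Φ.A (Φ.τ i.castSucc) * Φ.Estar 0))

/-- The second split sequence (written `\phi`), with indices shifted to start at `0`:
`secondSplit V i` is `\phi_{i+1}`, that is,
`(θ^*_0 - θ^*_{i+1}) tr(η_{i+1}(A) E^*_0) / tr(η_i(A) E^*_0)`. -/
noncomputable def secondSplit {K 𝒜 : Type*} [Field K] [Ring 𝒜] [Algebra K 𝒜] {d : ℕ}
    (Φ : LeonardSystem K 𝒜 d)
    (V : Type*) [AddCommGroup V] [Module K V] [Module 𝒜 V] [IsScalarTower K 𝒜 V]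
    (i : Fin d) : K :=
  (Φ.θstar 0 - Φ.θstar i.succ) *
    (actionTrace V (aeval Φ.A (Φ.η i.succ) * Φ.Estar 0) /
      actionTrace V (aeval Φ.A (Φ.η i.castSucc) * Φ.Estar 0))

/-- The switching element
`S = ∑_{r=0}^d (\phi_d \phi_{d-1} ⋯ \phi_{d-r+1}) / (\varphi_1 \varphi_2 ⋯ \varphi_r) E_r`.
In the shifted indices, `\phi_{d-h}` is `secondSplit V h.rev` and `\varphi_{h+1}` is
`firstSplit V h`, for `h = 0, …, r - 1`. -/
noncomputable def switchingElement {K 𝒜 : Type*} [Field K] [Ring 𝒜] [Algebra K 𝒜] {d : ℕ}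
    (Φ : LeonardSystem K 𝒜 d)
    (V : Type*) [AddCommGroup V] [Module K V] [Module 𝒜 V] [IsScalarTower K 𝒜 V] : 𝒜 :=
  ∑ r : Fin (d + 1),
    ((∏ h ∈ Finset.univ.filter (fun h : Fin d => (h : ℕ) < (r : ℕ)), Φ.secondSplit V h.rev) /
      (∏ h ∈ Finset.univ.filter (fun h : Fin d => (h : ℕ) < (r : ℕ)), Φ.firstSplit V h)) • Φ.E r

end LeonardSystem

/-- For `x ∈ 𝒜` and a sequence `F` of subspaces of `V`, the sequence `xF = {x F_i}`. -/
def actOnSeq {K 𝒜 : Type*} [Field K] [Ring 𝒜] [Algebra K 𝒜]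
    {V : Type*} [AddCommGroup V] [Module K V] [Module 𝒜 V] [IsScalarTower K 𝒜 V] {d : ℕ}
    (x : 𝒜) (F : Fin (d + 1) → Submodule K V) : Fin (d + 1) → Submodule K V :=
  fun i => (F i).map (Algebra.lsmul K K V x : V →ₗ[K] V)

/-- The subspace `xV` of `V`, for `x ∈ 𝒜`. -/
def imageSubspace (K : Type*) {𝒜 : Type*} [Field K] [Ring 𝒜] [Algebra K 𝒜]
    (V : Type*) [AddCommGroup V] [Module K V] [Module 𝒜 V] [IsScalarTower K 𝒜 V]
    (x : 𝒜) : Submodule K V :=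
  LinearMap.range (Algebra.lsmul K K V x : V →ₗ[K] V)

/-- The flags `[0]`, `[D]`, `[0^*]`, `[D^*]` on `V`. Their `i`-th components are, respectively,
`E_0V + ⋯ + E_iV`, `E_dV + ⋯ + E_{d-i}V`, `E^*_0V + ⋯ + E^*_iV`, `E^*_dV + ⋯ + E^*_{d-i}V`. -/
def LeonardSystem.flag {K 𝒜 : Type*} [Field K] [Ring 𝒜] [Algebra K 𝒜] {d : ℕ}
    (Φ : LeonardSystem K 𝒜 d)
    (V : Type*) [AddCommGroup V] [Module K V] [Module 𝒜 V] [IsScalarTower K 𝒜 V] :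
    FlagSymbol → Fin (d + 1) → Submodule K V
  | .zero, i => ⨆ j : Fin (d + 1), ⨆ _ : j ≤ i, imageSubspace K V (Φ.E j)
  | .D, i => ⨆ j : Fin (d + 1), ⨆ _ : j ≤ i, imageSubspace K V (Φ.E j.rev)
  | .zeroStar, i => ⨆ j : Fin (d + 1), ⨆ _ : j ≤ i, imageSubspace K V (Φ.Estar j)
  | .DStar, i => ⨆ j : Fin (d + 1), ⨆ _ : j ≤ i, imageSubspace K V (Φ.Estar j.rev)

/-! Let `v` and `w` be eigenbases of `A` and `A^*`, and let `a_r`, `b_r` be the `v`-coordinates of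
`w_0` and `w_d`. The vector `w_0` is cyclic for `A`: the span of `w_0, …, w_i` is `{p(A) w_0 : deg p
≤ i}`, and every `a_r` is nonzero; the same holds from the other end with `w_d` and `b_r`.

Preserving `[0]` and `[D]` means being diagonal in `v`. Sending `w_0` into `K w_d` then forces the
entries to be proportional to `b_r / a_r`, so such an `X` is unique up to a scalar
(`eq_smul_of_flag_le`). Conversely, a diagonal map with these entries commutes with `A`, hence takes
`p(A) w_0` to a multiple of `p(A) w_d`, which gives `[0^*] → [D^*]` (`w_repr_apply_eq_zero`). Its
entries are nonzero, so it is invertible and the inclusions are equalities by dimension.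

It remains to see that the coefficients of `S` are proportional to `b_r / a_r`
(`prod_split_div_prod_split`), which is a telescoping product of the ratios in
`split_reverseV_div_split`. The split basis `τ_n(A) w_0` expresses `φ` and `ϕ` through off-diagonal
entries of `A^*` in `v`. A diagonal bilinear form making `A^*` self-adjoint makes the `w_j`
orthogonal; testing `w_d` against `p(A) w_0`, where `p` of degree `d - 1` vanishes at all but two
consecutive eigenvalues, leaves the required two-term relation. -/

/-- The product `∏_{h < n} (X - θ_h)`. -/
noncomputable def initialRootProduct {K : Type*} [Field K] {d : ℕ} (θ : Fin (d + 1) → K)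
    (n : Fin (d + 1)) : K[X] :=
  ∏ h ∈ Finset.univ.filter (fun h : Fin (d + 1) => h < n), (X - C (θ h))

/-! ### Products of linear factors over an initial segment of eigenvalues. -/

section InitialRootProduct

variable {K : Type*} [Field K] {d : ℕ}

theorem initialRootProduct_zero (θ : Fin (d + 1) → K) : initialRootProduct θ 0 = 1 := by
  simp [initialRootProduct]

theorem filter_lt_succ (h : Fin d) :
    Finset.univ.filter (fun j : Fin (d + 1) => j < h.succ) =
      insert h.castSucc (Finset.univ.filter (fun j : Fin (d + 1) => j < h.castSucc)) := by
  ext j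
  simp only [Finset.mem_filter, Finset.mem_univ, true_and, Finset.mem_insert, Fin.lt_def,
    Fin.ext_iff, Fin.val_succ, Fin.val_castSucc]
  omega

theorem initialRootProduct_succ (θ : Fin (d + 1) → K) (h : Fin d) :
    initialRootProduct θ h.succ = initialRootProduct θ h.castSucc * (X - C (θ h.castSucc)) := by
  rw [initialRootProduct, filter_lt_succ, Finset.prod_insert (by simp), mul_comm]
  rfl

theorem natDegree_initialRootProduct (θ : Fin (d + 1) → K) (n : Fin (d + 1)) :
    (initialRootProduct θ n).natDegree = n := by
  rw [initialRootProduct, natDegree_prod_of_monic _ _ (fun i _ => monic_X_sub_C _)]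
  have : Finset.univ.filter (fun h : Fin (d + 1) => h < n) = Finset.Iio n := by ext; simp
  simp [this]

theorem eval_initialRootProduct_eq_zero (θ : Fin (d + 1) → K) {n i : Fin (d + 1)} (h : i < n) :
    (initialRootProduct θ n).eval (θ i) = 0 := by
  rw [initialRootProduct, eval_prod]
  exact Finset.prod_eq_zero (i := i) (by simpa using h) (by simp)

theorem eval_initialRootProduct_ne_zero {θ : Fin (d + 1) → K} (hθ : Function.Injective θ)
    {n i : Fin (d + 1)} (h : n ≤ i) : (initialRootProduct θ n).eval (θ i) ≠ 0 := by
  rw [initialRootProduct, eval_prod, Finset.prod_ne_zero_iff]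
  intro j hj
  simp only [Finset.mem_filter, Finset.mem_univ, true_and] at hj
  simp only [eval_sub, eval_X, eval_C, sub_ne_zero]
  exact fun e => (lt_of_lt_of_le hj h).ne' (hθ e)

end InitialRootProduct

/-! ### Coordinates of diagonalizable maps. -/

section BasisCoordinates

variable {ι K V : Type*} [Fintype ι] [Field K] [AddCommGroup V] [Module K V]

theorem Module.Basis.repr_end_apply (b : Module.Basis ι K V) (S : Module.End K V) (x : V) (i : ι) :
    b.repr (S x) i = ∑ j, b.repr x j * b.repr (S (b j)) i := by
  conv_lhs => rw [← b.sum_repr x]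
  simp only [map_sum, map_smul, Finsupp.finsetSum_apply, Finsupp.smul_apply, smul_eq_mul]

theorem Module.Basis.repr_diagonal_apply (b : Module.Basis ι K V) {S : Module.End K V} {c : ι → K}
    (h : ∀ j, S (b j) = c j • b j) (x : V) (i : ι) :
    b.repr (S x) i = c i * b.repr x i := by
  classical
  rw [b.repr_end_apply, Finset.sum_eq_single i]
  · simp [h, mul_comm]
  · intro j _ hj
    simp [h, hj]
  · simp

theorem aeval_apply_of_eigen {S : Module.End K V} {c : K} {x : V} (h : S x = c • x) (p : K[X]) :
    aeval S p x = p.eval c • x := by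
  by_cases hx : x = 0
  · simp [hx]
  · exact Module.End.aeval_apply_of_hasEigenvector
      ⟨Module.End.mem_eigenspace_iff.2 h, hx⟩

end BasisCoordinates

/-! ### Leonard pairs in coordinates, and their reversals. -/

/-- Two bases of `V`, the first one diagonalizing `T` and the second one diagonalizing `Ts`, both
with distinct eigenvalues, such that `Ts` is irreducible tridiagonal in the first basis and `T` is
irreducible tridiagonal in the second basis. -/
structure LeonardBases (K V : Type*) [Field K] [AddCommGroup V] [Module K V] (d : ℕ) where
  v : Module.Basis (Fin (d + 1)) K V
  w : Module.Basis (Fin (d + 1)) K V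
  T : Module.End K V
  Ts : Module.End K V
  θ : Fin (d + 1) → K
  θs : Fin (d + 1) → K
  θ_injective : Function.Injective θ
  θs_injective : Function.Injective θs
  T_v : ∀ i, T (v i) = θ i • v i
  Ts_w : ∀ i, Ts (w i) = θs i • w i
  Ts_v_eq_zero : ∀ i j : Fin (d + 1), (i.val + 1 < j.val ∨ j.val + 1 < i.val) →
    v.repr (Ts (v j)) i = 0
  Ts_v_ne_zero : ∀ i j : Fin (d + 1), (i.val + 1 = j.val ∨ j.val + 1 = i.val) →
    v.repr (Ts (v j)) i ≠ 0
  T_w_eq_zero : ∀ i j : Fin (d + 1), (i.val + 1 < j.val ∨ j.val + 1 < i.val) →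
    w.repr (T (w j)) i = 0
  T_w_ne_zero : ∀ i j : Fin (d + 1), (i.val + 1 = j.val ∨ j.val + 1 = i.val) →
    w.repr (T (w j)) i ≠ 0

namespace LeonardBases

variable {K V : Type*} [Field K] [AddCommGroup V] [Module K V] {d : ℕ} (L : LeonardBases K V d)

/-- Reversing the first basis. -/
noncomputable def reverseV : LeonardBases K V d where
  v := L.v.reindex Fin.revPerm
  w := L.w
  T := L.T
  Ts := L.Ts
  θ := fun i => L.θ i.rev
  θs := L.θs
  θ_injective := fun i j h => Fin.rev_injective (L.θ_injective h)
  θs_injective := L.θs_injective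
  T_v := fun i => by simpa using L.T_v i.rev
  Ts_w := L.Ts_w
  Ts_v_eq_zero := fun i j h => by
    simpa using L.Ts_v_eq_zero i.rev j.rev (by simp only [Fin.val_rev]; omega)
  Ts_v_ne_zero := fun i j h => by
    simpa using L.Ts_v_ne_zero i.rev j.rev (by simp only [Fin.val_rev]; omega)
  T_w_eq_zero := L.T_w_eq_zero
  T_w_ne_zero := L.T_w_ne_zero

/-- Reversing the second basis. -/
noncomputable def reverseW : LeonardBases K V d where
  v := L.v
  w := L.w.reindex Fin.revPerm
  T := L.T
  Ts := L.Ts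
  θ := L.θ
  θs := fun i => L.θs i.rev
  θ_injective := L.θ_injective
  θs_injective := fun i j h => Fin.rev_injective (L.θs_injective h)
  T_v := L.T_v
  Ts_w := fun i => by simpa using L.Ts_w i.rev
  Ts_v_eq_zero := L.Ts_v_eq_zero
  Ts_v_ne_zero := L.Ts_v_ne_zero
  T_w_eq_zero := fun i j h => by
    simpa using L.T_w_eq_zero i.rev j.rev (by simp only [Fin.val_rev]; omega)
  T_w_ne_zero := fun i j h => by
    simpa using L.T_w_ne_zero i.rev j.rev (by simp only [Fin.val_rev]; omega)

/-! ### Cyclicity of `w 0` under `T`. -/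

theorem repr_aeval_T (p : K[X]) (x : V) (i : Fin (d + 1)) :
    L.v.repr (aeval L.T p x) i = p.eval (L.θ i) * L.v.repr x i :=
  L.v.repr_diagonal_apply (fun j => aeval_apply_of_eigen (L.T_v j) p) x i

theorem w_repr_Ts (x : V) (i : Fin (d + 1)) : L.w.repr (L.Ts x) i = L.θs i * L.w.repr x i :=
  L.w.repr_diagonal_apply L.Ts_w x i

/-- Applying a polynomial of degree at most `n` in `T` to `w 0` gives a vector
supported on `w 0, …, w n`. -/
theorem w_repr_aeval_w_zero (p : K[X]) (i : Fin (d + 1)) (h : p.natDegree < i.val) :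
    L.w.repr (aeval L.T p (L.w 0)) i = 0 := by
  have key : ∀ (n : ℕ) (i : Fin (d + 1)), n < i.val →
      L.w.repr ((L.T ^ n) (L.w 0)) i = 0 := by
    intro n
    induction n with
    | zero =>
      intro i hi
      have : (0 : Fin (d + 1)) ≠ i := fun e => by simp [← e] at hi
      simp [this]
    | succ n ih =>
      intro i hi
      rw [pow_succ', Module.End.mul_apply, L.w.repr_end_apply]
      refine Finset.sum_eq_zero fun j _ => ?_
      by_cases hj : n < j.val
      · rw [ih j hj, zero_mul]
      · rw [L.T_w_eq_zero i j (by omega), mul_zero]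
  rw [aeval_eq_sum_range]
  simp only [LinearMap.sum_apply, map_sum, Finsupp.finsetSum_apply, LinearMap.smul_apply, map_smul,
    Finsupp.smul_apply]
  refine Finset.sum_eq_zero fun n hn => ?_
  rw [key n i (by simp at hn; omega), smul_zero]

/-- Each `w j` is a polynomial of degree at most `j` in `T`, applied to `w 0`. -/
theorem exists_polynomial_w (j : Fin (d + 1)) :
    ∃ p : K[X], p.natDegree ≤ j.val ∧ aeval L.T p (L.w 0) = L.w j := by
  obtain ⟨n, hn⟩ := j
  induction n using Nat.strong_induction_on with
  | _ n ih =>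
    cases n with
    | zero => exact ⟨1, by simp, by simp⟩
    | succ k =>
      have hk : k < d + 1 := by omega
      set c : Fin (d + 1) → K := fun i => L.w.repr (L.T (L.w ⟨k, hk⟩)) i with hc
      have hck : c ⟨k + 1, hn⟩ ≠ 0 := L.T_w_ne_zero _ _ (by simp)
      -- Putting the bound `i ≤ k` inside the existential, with junk value `0` beyond it, lets
      -- `choose` return a total function.
      have hp : ∀ i : Fin (d + 1), ∃ p : K[X], i.val ≤ k →
          p.natDegree ≤ i.val ∧ aeval L.T p (L.w 0) = L.w i := by
        intro i
        by_cases hi : i.val ≤ k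
        · obtain ⟨p, hp⟩ := ih i.val (by omega) i.isLt
          exact ⟨p, fun _ => hp⟩
        · exact ⟨0, fun h => absurd h hi⟩
      choose p hp using hp
      have hsum : L.T (L.w ⟨k, hk⟩) = c ⟨k + 1, hn⟩ • L.w ⟨k + 1, hn⟩ +
          ∑ i ∈ Finset.univ.filter (fun i : Fin (d + 1) => i.val ≤ k), c i • L.w i := by
        rw [← Finset.sum_insert (f := fun i => c i • L.w i) (by simp)]
        conv_lhs => rw [← L.w.sum_repr (L.T (L.w ⟨k, hk⟩))]
        symm
        refine Finset.sum_subset (Finset.subset_univ _) fun i _ hi => ?_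
        simp only [Finset.mem_insert, Finset.mem_filter, Finset.mem_univ, true_and, Fin.ext_iff,
          not_or, not_le] at hi
        have : c i = 0 := L.T_w_eq_zero i ⟨k, hk⟩ (by simp only; omega)
        rw [this, zero_smul]
      -- The expansion of `T w_k` solved for `w_{k+1}`, whose coefficient is nonzero by
      -- irreducibility.
      refine ⟨C (c ⟨k + 1, hn⟩)⁻¹ * (X * p ⟨k, hk⟩ -
        ∑ i ∈ Finset.univ.filter (fun i : Fin (d + 1) => i.val ≤ k), C (c i) * p i), ?_, ?_⟩
      · refine (natDegree_C_mul_le _ _).trans ((natDegree_sub_le _ _).trans (max_le ?_ ?_))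
        · refine natDegree_mul_le.trans ?_
          have := (hp ⟨k, hk⟩ le_rfl).1
          simp only [natDegree_X] at *
          omega
        · refine natDegree_sum_le_of_forall_le _ _ fun i hi => (natDegree_C_mul_le _ _).trans ?_
          simp only [Finset.mem_filter, Finset.mem_univ, true_and] at hi
          exact (hp i hi).1.trans (by simp only; omega)
      · have hs : aeval L.T (∑ i ∈ Finset.univ.filter (fun i : Fin (d + 1) => i.val ≤ k),
            C (c i) * p i) (L.w 0) =
            ∑ i ∈ Finset.univ.filter (fun i : Fin (d + 1) => i.val ≤ k), c i • L.w i := by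
          rw [map_sum, LinearMap.sum_apply]
          refine Finset.sum_congr rfl fun i hi => ?_
          simp only [Finset.mem_filter, Finset.mem_univ, true_and] at hi
          rw [map_mul, aeval_C, Module.End.mul_apply, (hp i hi).2, Module.algebraMap_end_apply]
        rw [map_mul, aeval_C, Module.End.mul_apply, map_sub, LinearMap.sub_apply, hs, map_mul,
          aeval_X, Module.End.mul_apply, (hp ⟨k, hk⟩ le_rfl).2, hsum, add_sub_cancel_right,
          Module.algebraMap_end_apply, smul_smul, inv_mul_cancel₀ hck, one_smul]

theorem exists_polynomial_of_w_repr (n : ℕ) (x : V)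
    (hx : ∀ i : Fin (d + 1), n < i.val → L.w.repr x i = 0) :
    ∃ p : K[X], p.natDegree ≤ n ∧ aeval L.T p (L.w 0) = x := by
  choose p hp using L.exists_polynomial_w
  refine ⟨∑ i, C (L.w.repr x i) * p i, ?_, ?_⟩
  · refine natDegree_sum_le_of_forall_le _ _ fun i _ => ?_
    by_cases hi : n < i.val
    · simp [hx i hi]
    · exact (natDegree_C_mul_le _ _).trans ((hp i).1.trans (by omega))
  · conv_rhs => rw [← L.w.sum_repr x]
    rw [map_sum, LinearMap.sum_apply]
    refine Finset.sum_congr rfl fun i _ => ?_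
    rw [map_mul, aeval_C, Module.End.mul_apply, (hp i).2, Module.algebraMap_end_apply]

/-- If the coordinate vanished, it would vanish for all `p(T) w_0`, yet `v_i` itself has that form.
-/
theorem v_repr_w_zero_ne_zero (i : Fin (d + 1)) : L.v.repr (L.w 0) i ≠ 0 := by
  intro h
  obtain ⟨p, -, hp⟩ := L.exists_polynomial_of_w_repr d (L.v i) (fun j hj => by omega)
  have := L.repr_aeval_T p (L.w 0) i
  rw [hp, h] at this
  simp at this

theorem v_repr_w_last_ne_zero (i : Fin (d + 1)) : L.v.repr (L.w (Fin.last d)) i ≠ 0 := by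
  simpa [reverseW] using L.reverseW.v_repr_w_zero_ne_zero i

/-- The subspaces spanned by `w 0, …, w i` and by `v (i + 1), …, v d` meet trivially. -/
theorem eq_zero_of_repr_eq_zero (i : Fin (d + 1)) (x : V)
    (hw : ∀ j, i < j → L.w.repr x j = 0) (hv : ∀ j, j ≤ i → L.v.repr x j = 0) : x = 0 := by
  classical
  obtain ⟨p, hp, rfl⟩ := L.exists_polynomial_of_w_repr i.val x (fun j hj => hw j hj)
  -- `p` has degree at most `i` but vanishes at the `i + 1` distinct points `θ_0, …, θ_i`.
  have : p = 0 := by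
    refine eq_zero_of_natDegree_lt_card_of_eval_eq_zero' p ((Finset.Iic i).image L.θ) ?_ ?_
    · intro c hc
      obtain ⟨j, hj, rfl⟩ := Finset.mem_image.1 hc
      have := hv j (by simpa using hj)
      rw [repr_aeval_T] at this
      exact (mul_eq_zero.1 this).resolve_right (L.v_repr_w_zero_ne_zero j)
    · rw [Finset.card_image_of_injective _ L.θ_injective, Fin.card_Iic]
      omega
  simp [this]

/-! ### The split basis and the split sequence. -/

/-- The vector `τ_n(T) w_0` of the split basis. -/
noncomputable def splitVector (n : Fin (d + 1)) : V :=
  aeval L.T (initialRootProduct L.θ n) (L.w 0)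

theorem v_repr_splitVector (n i : Fin (d + 1)) : L.v.repr (L.splitVector n) i =
    (initialRootProduct L.θ n).eval (L.θ i) * L.v.repr (L.w 0) i :=
  L.repr_aeval_T _ _ _

theorem v_repr_splitVector_eq_zero {n i : Fin (d + 1)} (h : i < n) :
    L.v.repr (L.splitVector n) i = 0 := by
  rw [v_repr_splitVector, eval_initialRootProduct_eq_zero _ h, zero_mul]

theorem v_repr_splitVector_ne_zero {n i : Fin (d + 1)} (h : n ≤ i) :
    L.v.repr (L.splitVector n) i ≠ 0 := by
  rw [v_repr_splitVector]
  exact mul_ne_zero (eval_initialRootProduct_ne_zero L.θ_injective h) (L.v_repr_w_zero_ne_zero i)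

theorem w_repr_splitVector_eq_zero {n i : Fin (d + 1)} (h : n < i) :
    L.w.repr (L.splitVector n) i = 0 :=
  L.w_repr_aeval_w_zero _ _ (by rw [natDegree_initialRootProduct]; exact h)

/-- The split vector involves only `v_j` with `j ≥ h + 1`, and `Ts` lowers indices by at most one,
so only `j = h + 1` reaches an index `i ≤ h`. -/
theorem v_repr_Ts_splitVector (h : Fin d) (i : Fin (d + 1)) (hi : i ≤ h.castSucc) :
    L.v.repr (L.Ts (L.splitVector h.succ)) i =
      L.v.repr (L.Ts (L.v h.succ)) i * L.v.repr (L.splitVector h.succ) h.succ := by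
  rw [L.v.repr_end_apply, Finset.sum_eq_single h.succ, mul_comm]
  · intro j _ hj
    rcases lt_or_gt_of_ne hj with hj | hj
    · rw [L.v_repr_splitVector_eq_zero hj, zero_mul]
    · rw [L.Ts_v_eq_zero, mul_zero]
      simp only [Fin.lt_def, Fin.le_def, Fin.val_succ, Fin.val_castSucc] at *
      omega
  · simp

/-- The action of `Ts` on the split basis. -/
theorem Ts_splitVector (h : Fin d) :
    L.Ts (L.splitVector h.succ) - L.θs h.succ • L.splitVector h.succ =
      (L.v.repr (L.Ts (L.v h.succ)) h.castSucc * L.v.repr (L.splitVector h.succ) h.succ /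
        L.v.repr (L.splitVector h.castSucc) h.castSucc) • L.splitVector h.castSucc := by
  rw [← sub_eq_zero]
  -- `Ts - θs_{h+1}` kills the `w_{h+1}`-coordinate, so the difference lies in the span of `w_0, …,
  -- w_h`; the scalar on the right is the one cancelling its `v_h`-coordinate.
  refine L.eq_zero_of_repr_eq_zero h.castSucc _ (fun j hj => ?_) (fun j hj => ?_)
  · simp only [map_sub, map_smul, Finsupp.sub_apply, Finsupp.smul_apply, smul_eq_mul,
      L.w_repr_Ts, L.w_repr_splitVector_eq_zero hj, mul_zero, sub_zero]
    rcases (Fin.castSucc_lt_iff_succ_le.1 hj).eq_or_lt with e | hj'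
    · rw [e, sub_self]
    · rw [L.w_repr_splitVector_eq_zero hj', mul_zero, mul_zero, sub_zero]
  · simp only [map_sub, map_smul, Finsupp.sub_apply, Finsupp.smul_apply, smul_eq_mul,
      L.v_repr_Ts_splitVector h j hj,
      L.v_repr_splitVector_eq_zero (hj.trans_lt h.castSucc_lt_succ), mul_zero, sub_zero]
    rcases hj.eq_or_lt with rfl | hj'
    · rw [div_mul_cancel₀ _ (L.v_repr_splitVector_ne_zero le_rfl), sub_self]
    · rw [L.v_repr_splitVector_eq_zero hj', L.Ts_v_eq_zero, zero_mul, mul_zero, sub_zero]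
      simp only [Fin.lt_def, Fin.val_succ, Fin.val_castSucc] at *
      omega

theorem w_repr_splitVector_succ (h : Fin d) :
    (L.θs 0 - L.θs h.succ) * L.w.repr (L.splitVector h.succ) 0 =
      (L.v.repr (L.Ts (L.v h.succ)) h.castSucc * L.v.repr (L.splitVector h.succ) h.succ /
        L.v.repr (L.splitVector h.castSucc) h.castSucc) *
          L.w.repr (L.splitVector h.castSucc) 0 := by
  have := congrArg (fun x => L.w.repr x 0) (L.Ts_splitVector h)
  simp only [map_sub, map_smul, Finsupp.sub_apply, Finsupp.smul_apply, smul_eq_mul,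
    L.w_repr_Ts] at this
  rw [← this, sub_mul]

/-- These coordinates are the traces in the denominators of the split sequences. Nonvanishing
propagates upward because the off-diagonal entries of `Ts` are nonzero. -/
theorem w_repr_splitVector_ne_zero (n : Fin (d + 1)) : L.w.repr (L.splitVector n) 0 ≠ 0 := by
  induction n using Fin.induction with
  | zero => simp [splitVector, initialRootProduct_zero]
  | succ h ih =>
    refine right_ne_zero_of_mul (a := L.θs 0 - L.θs h.succ) ?_
    rw [w_repr_splitVector_succ]
    exact mul_ne_zero (div_ne_zero (mul_ne_zero (L.Ts_v_ne_zero _ _ (by simp))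
      (L.v_repr_splitVector_ne_zero le_rfl)) (L.v_repr_splitVector_ne_zero le_rfl)) ih

/-- The split sequence. -/
noncomputable def split (h : Fin d) : K :=
  (L.θs 0 - L.θs h.succ) *
    (L.w.repr (L.splitVector h.succ) 0 / L.w.repr (L.splitVector h.castSucc) 0)

/-- The split sequence is the coefficient in `Ts_splitVector`, as the `w_0`-coordinate of that
identity shows. -/
theorem split_eq (h : Fin d) : L.split h =
    L.v.repr (L.Ts (L.v h.succ)) h.castSucc *
      ((initialRootProduct L.θ h.succ).eval (L.θ h.succ) * L.v.repr (L.w 0) h.succ) /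
      ((initialRootProduct L.θ h.castSucc).eval (L.θ h.castSucc) *
        L.v.repr (L.w 0) h.castSucc) := by
  rw [split, ← mul_div_assoc, w_repr_splitVector_succ,
    mul_div_cancel_right₀ _ (L.w_repr_splitVector_ne_zero _), v_repr_splitVector,
    v_repr_splitVector]

/-- In this form `ϕ_{d-h}` and `φ_{h+1}` involve the same pair of indices `h`, `h + 1`. -/
theorem split_reverseV_rev (h : Fin d) : L.reverseV.split h.rev =
    L.v.repr (L.Ts (L.v h.castSucc)) h.succ *
      ((initialRootProduct (fun i => L.θ i.rev) h.rev.succ).eval (L.θ h.castSucc) *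
        L.v.repr (L.w 0) h.castSucc) /
      ((initialRootProduct (fun i => L.θ i.rev) h.rev.castSucc).eval (L.θ h.succ) *
        L.v.repr (L.w 0) h.succ) := by
  rw [split_eq]
  simp [reverseV, Fin.rev_succ, Fin.rev_castSucc]

/-! ### Orthogonality of the `w_j` and the ratio formula. -/

/-- Weights of the diagonal bilinear form for which `Ts` is self-adjoint. -/
theorem exists_weights : ∃ m : Fin (d + 1) → K, (∀ i, m i ≠ 0) ∧
    ∀ i j, m i * L.v.repr (L.Ts (L.v j)) i = m j * L.v.repr (L.Ts (L.v i)) j := by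
  -- The recursion is symmetry at the pair `(h, h + 1)` solved for the next weight; tridiagonality
  -- leaves no other condition.
  let m : Fin (d + 1) → K := Fin.induction 1 fun h a =>
    a * L.v.repr (L.Ts (L.v h.succ)) h.castSucc / L.v.repr (L.Ts (L.v h.castSucc)) h.succ
  have hm : ∀ h : Fin d, m h.succ = m h.castSucc * L.v.repr (L.Ts (L.v h.succ)) h.castSucc /
      L.v.repr (L.Ts (L.v h.castSucc)) h.succ := fun h => Fin.induction_succ _ _ h
  have hstep : ∀ h : Fin d, m h.castSucc * L.v.repr (L.Ts (L.v h.succ)) h.castSucc =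
      m h.succ * L.v.repr (L.Ts (L.v h.castSucc)) h.succ := fun h => by
    rw [hm, div_mul_cancel₀ _ (L.Ts_v_ne_zero _ _ (by simp))]
  refine ⟨m, fun i => ?_, fun i j => ?_⟩
  · induction i using Fin.induction with
    | zero => exact one_ne_zero
    | succ h ih =>
      rw [hm]
      exact div_ne_zero (mul_ne_zero ih (L.Ts_v_ne_zero _ _ (by simp)))
        (L.Ts_v_ne_zero _ _ (by simp))
  · by_cases hij : i.val + 1 = j.val
    · let h : Fin d := ⟨i.val, by omega⟩
      have hi : i = h.castSucc := by ext; simp [h]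
      have hj : j = h.succ := by ext; simp [h, hij]
      rw [hi, hj, hstep]
    by_cases hji : j.val + 1 = i.val
    · let h : Fin d := ⟨j.val, by omega⟩
      have hj : j = h.castSucc := by ext; simp [h]
      have hi : i = h.succ := by ext; simp [h, hji]
      rw [hi, hj, hstep]
    by_cases e : i = j
    · rw [e]
    · have : i.val ≠ j.val := fun h => e (Fin.ext h)
      rw [L.Ts_v_eq_zero i j (by omega), L.Ts_v_eq_zero j i (by omega), mul_zero, mul_zero]

/-- Eigenvectors of the self-adjoint `Ts` for distinct eigenvalues are orthogonal. -/
theorem sum_weights_w_mul_w {m : Fin (d + 1) → K}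
    (hm : ∀ i j, m i * L.v.repr (L.Ts (L.v j)) i = m j * L.v.repr (L.Ts (L.v i)) j)
    {j k : Fin (d + 1)} (hjk : j ≠ k) :
    ∑ i, m i * L.v.repr (L.w j) i * L.v.repr (L.w k) i = 0 := by
  have hadj : ∀ x y : V, ∑ i, m i * L.v.repr (L.Ts x) i * L.v.repr y i =
      ∑ i, m i * L.v.repr x i * L.v.repr (L.Ts y) i := by
    intro x y
    have h1 : ∀ i, m i * L.v.repr (L.Ts x) i * L.v.repr y i =
        ∑ l, m i * L.v.repr (L.Ts (L.v l)) i * L.v.repr x l * L.v.repr y i := fun i => by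
      rw [L.v.repr_end_apply, Finset.mul_sum, Finset.sum_mul]
      exact Finset.sum_congr rfl fun l _ => by ring
    have h2 : ∀ i, m i * L.v.repr x i * L.v.repr (L.Ts y) i =
        ∑ l, m i * L.v.repr (L.Ts (L.v l)) i * L.v.repr y l * L.v.repr x i := fun i => by
      rw [L.v.repr_end_apply _ y, Finset.mul_sum]
      exact Finset.sum_congr rfl fun l _ => by ring
    rw [Finset.sum_congr rfl fun i _ => h1 i, Finset.sum_congr rfl fun i _ => h2 i,
      Finset.sum_comm]
    refine Finset.sum_congr rfl fun i _ => Finset.sum_congr rfl fun l _ => ?_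
    rw [hm]
    ring
  have h := hadj (L.w j) (L.w k)
  simp only [L.Ts_w, map_smul, Finsupp.smul_apply, smul_eq_mul] at h
  have h' : (L.θs j - L.θs k) * ∑ i, m i * L.v.repr (L.w j) i * L.v.repr (L.w k) i = 0 := by
    rw [sub_mul, Finset.mul_sum, Finset.mul_sum, sub_eq_zero]
    convert h using 2 <;> ring
  exact (mul_eq_zero.1 h').resolve_left (sub_ne_zero.2 fun e => hjk (L.θs_injective e))

/-- For `deg p < d` the vector `p(T) w_0` has no `w_d`-component, hence is orthogonal to `w_d`. -/
theorem sum_weights_w_last_mul_eval {m : Fin (d + 1) → K}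
    (hm : ∀ i j, m i * L.v.repr (L.Ts (L.v j)) i = m j * L.v.repr (L.Ts (L.v i)) j)
    (p : K[X]) (hp : p.natDegree < d) :
    ∑ i, m i * L.v.repr (L.w (Fin.last d)) i * (p.eval (L.θ i) * L.v.repr (L.w 0) i) = 0 := by
  simp only [← repr_aeval_T]
  set x := aeval L.T p (L.w 0) with hx
  have hxl : L.w.repr x (Fin.last d) = 0 := L.w_repr_aeval_w_zero p _ (by simpa using hp)
  have hxv : ∀ i, L.v.repr x i = ∑ k, L.w.repr x k * L.v.repr (L.w k) i := fun i => by
    conv_lhs => rw [← L.w.sum_repr x]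
    simp only [map_sum, map_smul, Finsupp.finsetSum_apply, Finsupp.smul_apply, smul_eq_mul]
  simp only [hxv, Finset.mul_sum]
  rw [Finset.sum_comm]
  refine Finset.sum_eq_zero fun k _ => ?_
  by_cases hk : k = Fin.last d
  · simp [hk, hxl]
  · have := L.sum_weights_w_mul_w hm (Ne.symm hk)
    rw [← mul_zero (L.w.repr x k), ← this, Finset.mul_sum]
    exact Finset.sum_congr rfl fun i _ => by ring

/-- Consecutive ratios of the coordinates of `w d` and of `w 0`. -/
theorem split_reverseV_div_split (h : Fin d) : L.reverseV.split h.rev / L.split h =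
    (L.v.repr (L.w (Fin.last d)) h.succ * L.v.repr (L.w 0) h.castSucc) /
      (L.v.repr (L.w (Fin.last d)) h.castSucc * L.v.repr (L.w 0) h.succ) := by
  obtain ⟨m, hm0, hm⟩ := L.exists_weights
  set τ := initialRootProduct L.θ h.castSucc with hτ
  set η := initialRootProduct (fun i => L.θ i.rev) h.rev.castSucc with hη
  have hrev : h.rev.castSucc.rev = h.succ := by rw [Fin.rev_castSucc, Fin.rev_rev]
  -- `τ * η` is the product of `X - θ_j` over `j ≠ h, h + 1`, of degree `h + (d - 1 - h)`.
  have hdeg : (τ * η).natDegree < d := by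
    refine natDegree_mul_le.trans_lt ?_
    rw [natDegree_initialRootProduct, natDegree_initialRootProduct]
    simp only [Fin.val_castSucc, Fin.val_rev]
    omega
  have hsum := L.sum_weights_w_last_mul_eval hm (τ * η) hdeg
  rw [← Finset.sum_subset (Finset.subset_univ {h.castSucc, h.succ}),
    Finset.sum_pair h.castSucc_lt_succ.ne] at hsum
  · have hB1 : L.v.repr (L.Ts (L.v h.succ)) h.castSucc ≠ 0 := L.Ts_v_ne_zero _ _ (by simp)
    have hB2 : L.v.repr (L.Ts (L.v h.castSucc)) h.succ ≠ 0 := L.Ts_v_ne_zero _ _ (by simp)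
    have hm' := hm h.castSucc h.succ
    have hτ0 : τ.eval (L.θ h.castSucc) ≠ 0 :=
      eval_initialRootProduct_ne_zero L.θ_injective le_rfl
    have hτ1 : τ.eval (L.θ h.succ) ≠ 0 :=
      eval_initialRootProduct_ne_zero L.θ_injective h.castSucc_lt_succ.le
    have hηi := L.reverseV.θ_injective
    have hη1 : η.eval (L.θ h.succ) ≠ 0 := by
      have := eval_initialRootProduct_ne_zero hηi (le_refl h.rev.castSucc)
      simpa only [reverseV, hrev] using this
    have hη0 : η.eval (L.θ h.castSucc) ≠ 0 := by
      have := eval_initialRootProduct_ne_zero hηi (h.rev.castSucc_lt_succ.le)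
      simpa only [reverseV, Fin.rev_succ, Fin.rev_rev] using this
    have ha0 := L.v_repr_w_zero_ne_zero h.castSucc
    have ha1 := L.v_repr_w_zero_ne_zero h.succ
    have hb0 := L.v_repr_w_last_ne_zero h.castSucc
    have hb1 := L.v_repr_w_last_ne_zero h.succ
    have hd : L.θ h.succ - L.θ h.castSucc ≠ 0 :=
      sub_ne_zero.2 fun e => h.castSucc_lt_succ.ne' (L.θ_injective e)
    rw [split_reverseV_rev, split_eq, initialRootProduct_succ, initialRootProduct_succ, ← hτ, ← hη,
      hrev]
    simp only [eval_mul, eval_sub, eval_X, eval_C] at hsum ⊢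
    generalize L.v.repr (L.Ts (L.v h.succ)) h.castSucc = B1 at *
    generalize L.v.repr (L.Ts (L.v h.castSucc)) h.succ = B2 at *
    generalize L.v.repr (L.w 0) h.castSucc = a0 at *
    generalize L.v.repr (L.w 0) h.succ = a1 at *
    generalize L.v.repr (L.w (Fin.last d)) h.castSucc = b0 at *
    generalize L.v.repr (L.w (Fin.last d)) h.succ = b1 at *
    have hm1 := hm0 h.castSucc
    have hm2 := hm0 h.succ
    generalize m h.castSucc = m0 at *
    generalize m h.succ = m1 at *
    generalize τ.eval (L.θ h.castSucc) = t0 at *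
    generalize τ.eval (L.θ h.succ) = t1 at *
    generalize η.eval (L.θ h.castSucc) = e0 at *
    generalize η.eval (L.θ h.succ) = e1 at *
    have hneg : L.θ h.castSucc - L.θ h.succ = -(L.θ h.succ - L.θ h.castSucc) := by ring
    rw [hneg]
    generalize L.θ h.succ - L.θ h.castSucc = δ at *
    rw [div_div_div_eq, div_eq_div_iff (by simp [*]) (by simp [*])]
    -- The extra factor `m_{h+1}` makes the goal a combination of the two-term relation `hsum` and
    -- the symmetry `hm'`, which eliminates the weights.
    refine mul_left_cancel₀ hm2 ?_
    linear_combination (δ * a0 ^ 2 * a1 * e0 * t0 * b0) * hm' - B1 * δ * a0 * a1 * hsum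
  · intro i _ hi
    simp only [Finset.mem_insert, Finset.mem_singleton, not_or] at hi
    suffices (τ * η).eval (L.θ i) = 0 by rw [this, zero_mul, mul_zero]
    rw [eval_mul]
    rcases lt_or_gt_of_ne hi.1 with hi' | hi'
    · rw [hτ, eval_initialRootProduct_eq_zero _ hi', zero_mul]
    · have : i.rev < h.rev.castSucc := by
        rw [← Fin.rev_lt_rev, Fin.rev_rev, hrev]
        exact lt_of_le_of_ne (Fin.castSucc_lt_iff_succ_le.1 hi') (Ne.symm hi.2)
      have := eval_initialRootProduct_eq_zero (fun i => L.θ i.rev) this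
      simp only [Fin.rev_rev] at this
      rw [this, mul_zero]

theorem prod_split_div_prod_split (r : Fin (d + 1)) :
    (∏ h ∈ Finset.univ.filter (fun h : Fin d => (h : ℕ) < (r : ℕ)), L.reverseV.split h.rev) /
      (∏ h ∈ Finset.univ.filter (fun h : Fin d => (h : ℕ) < (r : ℕ)), L.split h) =
    (L.v.repr (L.w 0) 0 / L.v.repr (L.w (Fin.last d)) 0) *
      (L.v.repr (L.w (Fin.last d)) r / L.v.repr (L.w 0) r) := by
  have ha := L.v_repr_w_zero_ne_zero
  have hb := L.v_repr_w_last_ne_zero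
  rw [← Finset.prod_div_distrib]
  induction r using Fin.induction with
  | zero =>
    have := ha 0
    have := hb 0
    simp
    field_simp
  | succ r ih =>
    have hins : Finset.univ.filter (fun h : Fin d => (h : ℕ) < (r.succ : ℕ)) =
        insert r (Finset.univ.filter (fun h : Fin d => (h : ℕ) < (r.castSucc : ℕ))) := by
      ext j
      simp only [Finset.mem_filter, Finset.mem_univ, true_and, Finset.mem_insert, Fin.ext_iff,
        Fin.val_succ, Fin.val_castSucc]
      omega
    rw [hins, Finset.prod_insert (by simp), ih, split_reverseV_div_split]
    have := ha 0
    have := hb 0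
    have := ha r.succ
    have := hb r.succ
    have := ha r.castSucc
    have := hb r.castSucc
    field_simp

end LeonardBases

/-! ### Membership and dimension in the flag of a basis. -/

section BasisFlag

variable {K V : Type*} [Field K] [AddCommGroup V] [Module K V] {d : ℕ}

theorem Module.Basis.mem_iSup_span_iff (b : Module.Basis (Fin (d + 1)) K V) (i : Fin (d + 1))
    (x : V) : x ∈ (⨆ j : Fin (d + 1), ⨆ _ : j ≤ i, Submodule.span K {b j}) ↔
      ∀ j, i < j → b.repr x j = 0 := by
  have : (⨆ j : Fin (d + 1), ⨆ _ : j ≤ i, Submodule.span K {b j}) =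
      Submodule.span K (b '' {j | j ≤ i}) := by
    rw [Set.image_eq_iUnion, Submodule.span_iUnion₂]
    rfl
  rw [this, b.mem_span_image]
  constructor
  · intro h j hj
    by_contra hne
    exact absurd (h (Finsupp.mem_support_iff.2 hne)) (not_le.2 hj)
  · intro h j hj
    by_contra hne
    exact Finsupp.mem_support_iff.1 hj (h j (not_le.1 hne))

theorem Module.Basis.finrank_iSup_span (b : Module.Basis (Fin (d + 1)) K V) (i : Fin (d + 1)) :
    Module.finrank K ↥(⨆ j : Fin (d + 1), ⨆ _ : j ≤ i, Submodule.span K {b j}) = i.val + 1 := by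
  have : (⨆ j : Fin (d + 1), ⨆ _ : j ≤ i, Submodule.span K {b j}) =
      Submodule.span K (Set.range fun j : Finset.Iic i => b j) := by
    rw [show (Set.range fun j : Finset.Iic i => b j) = b '' {j | j ≤ i} by ext; simp,
      Set.image_eq_iUnion, Submodule.span_iUnion₂]
    rfl
  have hli : LinearIndependent K fun j : Finset.Iic i => b j :=
    b.linearIndependent.comp _ Subtype.val_injective
  rw [this, finrank_span_eq_card hli, Fintype.card_coe, Fin.card_Iic]

end BasisFlag

/-! ### Diagonal maps carrying `w_0` to a multiple of `w_d`. -/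

namespace LeonardBases

variable {K V : Type*} [Field K] [AddCommGroup V] [Module K V] {d : ℕ} (L : LeonardBases K V d)

theorem apply_w_zero {S : Module.End K V} {s : Fin (d + 1) → K} {c : K}
    (hS : ∀ r, S (L.v r) = s r • L.v r)
    (hs : ∀ r, s r = c * (L.v.repr (L.w (Fin.last d)) r / L.v.repr (L.w 0) r)) :
    S (L.w 0) = c • L.w (Fin.last d) := by
  refine L.v.ext_elem fun i => ?_
  rw [L.v.repr_diagonal_apply hS, hs, map_smul, Finsupp.smul_apply, smul_eq_mul, mul_assoc,
    div_mul_cancel₀ _ (L.v_repr_w_zero_ne_zero i)]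

/-- `S` and `T` are both diagonal in `v`, so they commute and `S p(T) w_0 = c p(T) w_d`; in the
reversed order `w_d` is the initial vector. -/
theorem w_repr_apply_eq_zero {S : Module.End K V} {s : Fin (d + 1) → K} {c : K}
    (hS : ∀ r, S (L.v r) = s r • L.v r) (hw : S (L.w 0) = c • L.w (Fin.last d))
    {i : Fin (d + 1)} {x : V} (hx : ∀ j, i < j → L.w.repr x j = 0) (j : Fin (d + 1)) (hj : i < j) :
    L.reverseW.w.repr (S x) j = 0 := by
  obtain ⟨p, hp, rfl⟩ := L.exists_polynomial_of_w_repr i.val x fun j hj => hx j hj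
  have hcomm : S (aeval L.T p (L.w 0)) = aeval L.T p (S (L.w 0)) := by
    refine L.v.ext_elem fun k => ?_
    rw [L.v.repr_diagonal_apply hS, repr_aeval_T, repr_aeval_T, L.v.repr_diagonal_apply hS]
    ring
  have h := L.reverseW.w_repr_aeval_w_zero p j (lt_of_le_of_lt hp hj)
  have h0 : L.reverseW.w 0 = L.w (Fin.last d) := by simp [reverseW]
  rw [h0] at h
  rw [hcomm, hw, map_smul, map_smul, Finsupp.smul_apply]
  exact smul_eq_zero_of_right c h

/-- Upper and lower triangular together give `X` diagonal, say with entries `t_r`. Comparing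
`v`-coordinates in `X w_0 = e w_d` determines every `t_r`, since those of `w_0` are nonzero. -/
theorem eq_smul_of_flag_le {X S : Module.End K V} {s : Fin (d + 1) → K} {c : K} (hc : c ≠ 0)
    (hS : ∀ r, S (L.v r) = s r • L.v r)
    (hs : ∀ r, s r = c * (L.v.repr (L.w (Fin.last d)) r / L.v.repr (L.w 0) r))
    (h0 : ∀ r j, r < j → L.v.repr (X (L.v r)) j = 0)
    (hD : ∀ r j, j < r → L.v.repr (X (L.v r)) j = 0)
    (hw : ∀ j, j ≠ Fin.last d → L.w.repr (X (L.w 0)) j = 0) :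
    ∃ a : K, X = a • S := by
  set t : Fin (d + 1) → K := fun r => L.v.repr (X (L.v r)) r with ht
  have hX : ∀ r, X (L.v r) = t r • L.v r := fun r => by
    refine L.v.ext_elem fun j => ?_
    rcases lt_trichotomy r j with hj | rfl | hj
    · simp [h0 r j hj, hj.ne]
    · simp [ht]
    · simp [hD r j hj, hj.ne']
  set e := L.w.repr (X (L.w 0)) (Fin.last d) with he
  have hXw : X (L.w 0) = e • L.w (Fin.last d) := by
    refine L.w.ext_elem fun j => ?_
    by_cases hj : j = Fin.last d
    · simp [hj, he]
    · simp [hw j hj, Ne.symm hj]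
  refine ⟨e / c, L.v.ext fun r => ?_⟩
  rw [LinearMap.smul_apply, hX, hS, smul_smul]
  congr 1
  have h1 : t r * L.v.repr (L.w 0) r = e * L.v.repr (L.w (Fin.last d)) r := by
    rw [← L.v.repr_diagonal_apply hX, hXw, map_smul, Finsupp.smul_apply, smul_eq_mul]
  have := L.v_repr_w_zero_ne_zero r
  rw [hs]
  field_simp
  exact h1

end LeonardBases

/-! ### Simple modules over a matrix algebra. -/

section SimpleModule

variable {K 𝒜 V : Type*} [Field K] [Ring 𝒜] [Algebra K 𝒜] {n : Type*} [Fintype n] [DecidableEq n]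
  [AddCommGroup V] [Module K V] [Module 𝒜 V] [IsScalarTower K 𝒜 V] [IsSimpleModule 𝒜 V]

/-- A simple module over an algebra isomorphic to a full matrix algebra is isomorphic to the space
of column vectors. -/
theorem nonempty_pi_linearEquiv_of_matrix (e : 𝒜 ≃ₐ[K] Matrix n n K) :
    Nonempty ((n → K) ≃ₗ[K] V) := by
  let u : n → n → 𝒜 := fun i j => e.symm (Matrix.single i j 1)
  have hu : ∀ i j k l, u i j * u k l = if j = k then u i l else 0 := fun i j k l => by
    simp only [u, ← map_mul]
    split_ifs with h
    · subst h; simp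
    · simp [Matrix.single_mul_single_of_ne, h]
  have hspan : ∀ a : 𝒜, a = ∑ i, ∑ j, e a i j • u i j := fun a => by
    apply e.injective
    simp only [map_sum, map_smul, u, AlgEquiv.apply_symm_apply]
    conv_lhs => rw [Matrix.matrix_eq_sum_single (e a)]
    simp [Matrix.smul_single]
  have hone : (1 : 𝒜) = ∑ i, u i i := by
    apply e.injective
    simp only [map_sum, u, AlgEquiv.apply_symm_apply, map_one]
    exact (Matrix.sum_single_one).symm
  have : Nontrivial V := IsSimpleModule.nontrivial 𝒜 V
  obtain ⟨x, hx⟩ := exists_ne (0 : V)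
  -- The diagonal matrix units sum to `1`, so they cannot all kill `x`; the vectors `u i k • x` will
  -- be the basis.
  obtain ⟨k, hk⟩ : ∃ k, u k k • x ≠ 0 := by
    by_contra! h
    apply hx
    rw [← one_smul 𝒜 x, hone, Finset.sum_smul, Finset.sum_eq_zero fun i _ => h i]
  let f : (n → K) →ₗ[K] V := Fintype.linearCombination K fun i => u i k • x
  have hf : ∀ c, f c = ∑ i, c i • u i k • x := fun c => Fintype.linearCombination_apply _ _ _
  have huf : ∀ i j c, u i j • f c = c j • u i k • x := fun i j c => by
    rw [hf, Finset.smul_sum, Finset.sum_eq_single j]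
    · rw [smul_algebra_smul_comm, smul_smul, hu, if_pos rfl]
    · intro l _ hl
      rw [smul_algebra_smul_comm, smul_smul, hu, if_neg hl.symm, zero_smul, smul_zero]
    · simp
  refine ⟨LinearEquiv.ofBijective f ⟨?_, ?_⟩⟩
  · rw [← LinearMap.ker_eq_bot, LinearMap.ker_eq_bot']
    intro c hc
    funext j
    have h := huf k j c
    rw [hc, smul_zero] at h
    exact (smul_eq_zero.1 h.symm).resolve_right hk
  · let W : Submodule 𝒜 V :=
      { carrier := Set.range f
        add_mem' := by
          rintro _ _ ⟨a, rfl⟩ ⟨b, rfl⟩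
          exact ⟨a + b, map_add _ _ _⟩
        zero_mem' := ⟨0, map_zero _⟩
        smul_mem' := by
          rintro a _ ⟨c, rfl⟩
          refine ⟨fun i => ∑ j, e a i j * c j, ?_⟩
          conv_rhs => rw [hspan a]
          rw [hf]
          simp only [Finset.sum_smul, smul_assoc, huf, mul_smul] }
    have hW : W = ⊤ := by
      refine (eq_bot_or_eq_top W).resolve_left fun h => hk ?_
      have : f (Pi.single k 1) ∈ W := ⟨_, rfl⟩
      rw [h, Submodule.mem_bot] at this
      simpa [f] using this
    intro y
    exact (hW ▸ Submodule.mem_top : y ∈ W)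

/-- Injective because `𝒜` is a simple ring, then surjective by equality of dimensions. -/
theorem lsmul_bijective_of_matrix (e : 𝒜 ≃ₐ[K] Matrix n n K) :
    Function.Bijective (Algebra.lsmul K K V : 𝒜 →ₐ[K] Module.End K V) := by
  obtain ⟨f⟩ := nonempty_pi_linearEquiv_of_matrix (V := V) e
  have : Nontrivial V := IsSimpleModule.nontrivial 𝒜 V
  have : Nonempty n := by
    by_contra h
    rw [not_nonempty_iff] at h
    exact not_subsingleton V f.symm.toEquiv.subsingleton
  have : IsSimpleRing 𝒜 := IsSimpleRing.of_ringEquiv e.symm.toRingEquiv inferInstance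
  have hinj : Function.Injective (Algebra.lsmul K K V : 𝒜 →ₐ[K] Module.End K V) :=
    (Algebra.lsmul K K V : 𝒜 →ₐ[K] Module.End K V).toRingHom.injective
  have : FiniteDimensional K 𝒜 := Module.Finite.equiv e.symm.toLinearEquiv
  have : FiniteDimensional K V := Module.Finite.equiv f
  refine ⟨hinj, (LinearMap.injective_iff_surjective_of_finrank_eq_finrank
    (f := (Algebra.lsmul K K V : 𝒜 →ₐ[K] Module.End K V).toLinearMap) ?_).1 hinj⟩
  rw [e.toLinearEquiv.finrank_eq, Module.finrank_linearMap, ← f.finrank_eq, Module.finrank_matrix]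
  simp

end SimpleModule

/-! ### Eigenbases and primitive idempotents. -/

section Eigenbasis

variable {K 𝒜 V : Type*} [Field K] [Ring 𝒜] [Algebra K 𝒜] {d : ℕ}
  [AddCommGroup V] [Module K V] [Module 𝒜 V] [IsScalarTower K 𝒜 V] [IsSimpleModule 𝒜 V]

theorem exists_basis_of_isEigenvalueOrdering (e : 𝒜 ≃ₐ[K] Matrix (Fin (d + 1)) (Fin (d + 1)) K)
    {A : 𝒜} {θ : Fin (d + 1) → K} (h : IsEigenvalueOrdering A θ) :
    ∃ b : Module.Basis (Fin (d + 1)) K V,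
      (∀ i, Algebra.lsmul K K V A (b i) = θ i • b i) ∧
      ∀ i x, Algebra.lsmul K K V (primitiveIdempotent A θ i) x = b.repr x i • b i := by
  obtain ⟨f⟩ := nonempty_pi_linearEquiv_of_matrix (V := V) e
  have : FiniteDimensional K V := Module.Finite.equiv f
  let ρ : 𝒜 ≃ₐ[K] Module.End K V := AlgEquiv.ofBijective _ (lsmul_bijective_of_matrix e)
  have hev : ∀ i, Module.End.HasEigenvalue (Algebra.lsmul K K V A) (θ i) := fun i => by
    rw [Module.End.hasEigenvalue_iff_mem_spectrum]
    have : θ i ∈ spectrum K A := h.2 ▸ Set.mem_range_self i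
    rwa [← AlgEquiv.spectrum_eq ρ A] at this
  choose y hy using fun i => (hev i).exists_hasEigenvector
  have hli := Module.End.eigenvectors_linearIndependent' _ θ h.1 y hy
  let b := basisOfLinearIndependentOfCardEqFinrank hli (by simp [← f.finrank_eq])
  have hb : ∀ i, b i = y i := fun i => by simp [b]
  have hAb : ∀ i, Algebra.lsmul K K V A (b i) = θ i • b i := fun i => by
    rw [hb]
    exact (hy i).apply_eq_smul
  refine ⟨b, hAb, fun i x => ?_⟩
  refine b.ext_elem fun j => ?_
  -- The idempotent is the Lagrange polynomial at `θ i` evaluated at `A`, hence acts as `1` on `b i`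
  -- and `0` on the other `b j`.
  rw [primitiveIdempotent, ← aeval_algHom_apply,
    b.repr_diagonal_apply (fun k => aeval_apply_of_eigen (hAb k) _), eval_prod]
  by_cases hij : j = i
  · subst hij
    rw [Finset.prod_eq_one]
    · simp
    · intro k hk
      have : θ j - θ k ≠ 0 := sub_ne_zero.2 fun e => (Finset.ne_of_mem_erase hk) (h.1 e).symm
      simp [this]
  · rw [Finset.prod_eq_zero (i := j) (by simp [hij]) (by simp)]
    simp [Ne.symm hij]

end Eigenbasis

/-! ### Matrix entries, images and traces via rank-one idempotents. -/

section RankOneIdempotents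

variable {K 𝒜 V : Type*} [Field K] [Ring 𝒜] [Algebra K 𝒜] {d : ℕ}
  [AddCommGroup V] [Module K V] [Module 𝒜 V] [IsScalarTower K 𝒜 V]

theorem lsmul_mul_mul_apply {b : Module.Basis (Fin (d + 1)) K V} {E : Fin (d + 1) → 𝒜}
    (hE : ∀ i x, Algebra.lsmul K K V (E i) x = b.repr x i • b i) (B : 𝒜) (i j : Fin (d + 1))
    (x : V) : Algebra.lsmul K K V (E i * B * E j) x =
      (b.repr x j * b.repr (Algebra.lsmul K K V B (b j)) i) • b i := by
  rw [map_mul, map_mul, Module.End.mul_apply, Module.End.mul_apply, hE j, hE i, map_smul, map_smul,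
    Finsupp.smul_apply, smul_eq_mul]

theorem repr_eq_zero_of_mul_eq_zero {b : Module.Basis (Fin (d + 1)) K V} {E : Fin (d + 1) → 𝒜}
    (hE : ∀ i x, Algebra.lsmul K K V (E i) x = b.repr x i • b i) {B : 𝒜} {i j : Fin (d + 1)}
    (h : E i * B * E j = 0) : b.repr (Algebra.lsmul K K V B (b j)) i = 0 := by
  have := lsmul_mul_mul_apply hE B i j (b j)
  rw [h, map_zero] at this
  simpa [b.ne_zero] using this.symm

theorem mul_eq_zero_of_repr_eq_zero [IsSimpleModule 𝒜 V] (e : 𝒜 ≃ₐ[K] Matrix (Fin (d + 1)) (Fin (d + 1)) K)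
    {b : Module.Basis (Fin (d + 1)) K V} {E : Fin (d + 1) → 𝒜}
    (hE : ∀ i x, Algebra.lsmul K K V (E i) x = b.repr x i • b i) {B : 𝒜} {i j : Fin (d + 1)}
    (h : b.repr (Algebra.lsmul K K V B (b j)) i = 0) : E i * B * E j = 0 := by
  apply (lsmul_bijective_of_matrix (V := V) e).1
  rw [map_zero]
  refine LinearMap.ext fun x => ?_
  rw [lsmul_mul_mul_apply hE, h, mul_zero, zero_smul, LinearMap.zero_apply]

theorem imageSubspace_eq_span {b : Module.Basis (Fin (d + 1)) K V} {E : 𝒜} {i : Fin (d + 1)}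
    (hE : ∀ x, Algebra.lsmul K K V E x = b.repr x i • b i) :
    imageSubspace K V E = Submodule.span K {b i} := by
  ext y
  rw [Submodule.mem_span_singleton]
  constructor
  · rintro ⟨x, rfl⟩
    exact ⟨_, (hE x).symm⟩
  · rintro ⟨c, rfl⟩
    exact ⟨c • b i, by rw [hE]; simp⟩

/-- `B * E` has rank at most one, sending `x` to its `i`-th coordinate times `B b_i`. -/
theorem actionTrace_mul_eq {b : Module.Basis (Fin (d + 1)) K V} {E : 𝒜} {i : Fin (d + 1)}
    (hE : ∀ x, Algebra.lsmul K K V E x = b.repr x i • b i) (B : 𝒜) :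
    actionTrace V (B * E) = b.repr (Algebra.lsmul K K V B (b i)) i := by
  have : (Algebra.lsmul K K V (B * E) : V →ₗ[K] V) =
      (b.coord i).smulRight (Algebra.lsmul K K V B (b i)) := by
    refine LinearMap.ext fun x => ?_
    rw [map_mul, Module.End.mul_apply, hE, map_smul]
    rfl
  have hfin : Module.Finite K V := Module.Finite.of_basis b
  rw [actionTrace, this, LinearMap.trace_smulRight]
  rfl

end RankOneIdempotents

/-! ### From Leonard systems to pairs of bases. -/

section Transfer

variable {K 𝒜 V : Type*} [Field K] [Ring 𝒜] [Algebra K 𝒜] {d : ℕ}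
  [AddCommGroup V] [Module K V] [Module 𝒜 V] [IsScalarTower K 𝒜 V]

theorem one_lt_abs_sub_of_val {i j : Fin (d + 1)} (h : i.val + 1 < j.val ∨ j.val + 1 < i.val) :
    1 < |((i : ℕ) : ℤ) - ((j : ℕ) : ℤ)| := by
  rw [lt_abs]
  omega

theorem abs_sub_eq_one_of_val {i j : Fin (d + 1)} (h : i.val + 1 = j.val ∨ j.val + 1 = i.val) :
    |((i : ℕ) : ℤ) - ((j : ℕ) : ℤ)| = 1 := by
  rw [abs_eq zero_le_one]
  omega

theorem LeonardSystem.exists_leonardBases [IsSimpleModule 𝒜 V] (Φ : LeonardSystem K 𝒜 d)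
    (e : 𝒜 ≃ₐ[K] Matrix (Fin (d + 1)) (Fin (d + 1)) K) :
    ∃ L : LeonardBases K V d, L.T = Algebra.lsmul K K V Φ.A ∧ L.θ = Φ.θ ∧ L.θs = Φ.θstar ∧
      (∀ i x, Algebra.lsmul K K V (Φ.E i) x = L.v.repr x i • L.v i) ∧
      ∀ i x, Algebra.lsmul K K V (Φ.Estar i) x = L.w.repr x i • L.w i := by
  obtain ⟨hθ, hE⟩ := Φ.idempotents_E.choose_spec
  obtain ⟨hθs, hEs⟩ := Φ.idempotents_Estar.choose_spec
  obtain ⟨v, hv, hvE⟩ := exists_basis_of_isEigenvalueOrdering (V := V) e hθ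
  obtain ⟨w, hw, hwE⟩ := exists_basis_of_isEigenvalueOrdering (V := V) e hθs
  simp only [← hE] at hvE
  simp only [← hEs] at hwE
  exact ⟨{
    v := v
    w := w
    T := Algebra.lsmul K K V Φ.A
    Ts := Algebra.lsmul K K V Φ.Astar
    θ := Φ.θ
    θs := Φ.θstar
    θ_injective := hθ.1
    θs_injective := hθs.1
    T_v := hv
    Ts_w := hw
    Ts_v_eq_zero := fun i j h =>
      repr_eq_zero_of_mul_eq_zero hvE (Φ.E_Astar_E_eq_zero i j (one_lt_abs_sub_of_val h))
    Ts_v_ne_zero := fun i j h h' => Φ.E_Astar_E_ne_zero i j (abs_sub_eq_one_of_val h)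
      (mul_eq_zero_of_repr_eq_zero e hvE h')
    T_w_eq_zero := fun i j h =>
      repr_eq_zero_of_mul_eq_zero hwE (Φ.Estar_A_Estar_eq_zero i j (one_lt_abs_sub_of_val h))
    T_w_ne_zero := fun i j h h' => Φ.Estar_A_Estar_ne_zero i j (abs_sub_eq_one_of_val h)
      (mul_eq_zero_of_repr_eq_zero e hwE h') }, rfl, rfl, rfl, hvE, hwE⟩

theorem LeonardSystem.firstSplit_eq (Φ : LeonardSystem K 𝒜 d) {L : LeonardBases K V d}
    (hT : L.T = Algebra.lsmul K K V Φ.A) (hθ : L.θ = Φ.θ) (hθs : L.θs = Φ.θstar)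
    (hw : ∀ i x, Algebra.lsmul K K V (Φ.Estar i) x = L.w.repr x i • L.w i) (h : Fin d) :
    Φ.firstSplit V h = L.split h := by
  rw [firstSplit, LeonardBases.split, actionTrace_mul_eq (hw 0), actionTrace_mul_eq (hw 0),
    ← aeval_algHom_apply, ← aeval_algHom_apply, ← hT, hθs]
  simp only [LeonardBases.splitVector, hθ]
  rfl

theorem LeonardSystem.secondSplit_eq (Φ : LeonardSystem K 𝒜 d) {L : LeonardBases K V d}
    (hT : L.T = Algebra.lsmul K K V Φ.A) (hθ : L.θ = Φ.θ) (hθs : L.θs = Φ.θstar)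
    (hw : ∀ i x, Algebra.lsmul K K V (Φ.Estar i) x = L.w.repr x i • L.w i) (h : Fin d) :
    Φ.secondSplit V h = L.reverseV.split h := by
  rw [secondSplit, LeonardBases.split, actionTrace_mul_eq (hw 0), actionTrace_mul_eq (hw 0),
    ← aeval_algHom_apply, ← aeval_algHom_apply, ← hT]
  simp only [LeonardBases.splitVector, LeonardBases.reverseV, hθ, hθs]
  rfl

end Transfer

/-! ### The main theorem. -/

/-- `𝒜` is a `K`-algebra isomorphic to the algebra of `(d+1) × (d+1)` matrices, `V` is a simple
left `𝒜`-module (with the `K`-vector space structure coming from `K → 𝒜`), and inclusion of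
sequences of subspaces is componentwise. -/
theorem theorem8p1 {K 𝒜 V : Type*} [Field K] [Ring 𝒜] [Algebra K 𝒜] (d : ℕ)
    (h𝒜 : Nonempty (𝒜 ≃ₐ[K] Matrix (Fin (d + 1)) (Fin (d + 1)) K))
    [AddCommGroup V] [Module K V] [Module 𝒜 V] [IsScalarTower K 𝒜 V] [IsSimpleModule 𝒜 V]
    (Φ : LeonardSystem K 𝒜 d) (X : 𝒜) (hX : X ≠ 0) :
    ((∃ c : K, X = c • Φ.switchingElement V) ↔
      (actOnSeq X (Φ.flag V .zero) ≤ Φ.flag V .zero ∧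
        actOnSeq X (Φ.flag V .D) ≤ Φ.flag V .D ∧
        actOnSeq X (Φ.flag V .zeroStar) ≤ Φ.flag V .DStar)) ∧
    ((∃ c : K, X = c • Φ.switchingElement V) →
      actOnSeq X (Φ.flag V .zero) = Φ.flag V .zero ∧
        actOnSeq X (Φ.flag V .D) = Φ.flag V .D ∧
        actOnSeq X (Φ.flag V .zeroStar) = Φ.flag V .DStar) := by
  obtain ⟨e⟩ := h𝒜
  obtain ⟨L, hT, hθ, hθs, hv, hw⟩ := Φ.exists_leonardBases (V := V) e
  have hinj := (lsmul_bijective_of_matrix (V := V) e).1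
  have hfin : Module.Finite K V := Module.Finite.of_basis L.v
  have flag_zero : ∀ i, Φ.flag V .zero i =
      ⨆ j : Fin (d + 1), ⨆ _ : j ≤ i, Submodule.span K {L.v j} := fun i => by
    simp only [LeonardSystem.flag, imageSubspace_eq_span (hv _)]
  have flag_D : ∀ i, Φ.flag V .D i =
      ⨆ j : Fin (d + 1), ⨆ _ : j ≤ i, Submodule.span K {L.reverseV.v j} := fun i => by
    simp [LeonardSystem.flag, imageSubspace_eq_span (hv _), LeonardBases.reverseV]
  have flag_zeroStar : ∀ i, Φ.flag V .zeroStar i =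
      ⨆ j : Fin (d + 1), ⨆ _ : j ≤ i, Submodule.span K {L.w j} := fun i => by
    simp only [LeonardSystem.flag, imageSubspace_eq_span (hw _)]
  have flag_DStar : ∀ i, Φ.flag V .DStar i =
      ⨆ j : Fin (d + 1), ⨆ _ : j ≤ i, Submodule.span K {L.reverseW.w j} := fun i => by
    simp [LeonardSystem.flag, imageSubspace_eq_span (hw _), LeonardBases.reverseW]
  set a := L.v.repr (L.w 0) with ha
  set b := L.v.repr (L.w (Fin.last d)) with hb
  have ha0 := L.v_repr_w_zero_ne_zero
  have hb0 := L.v_repr_w_last_ne_zero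
  have hc : a 0 / b 0 ≠ 0 := div_ne_zero (ha0 0) (hb0 0)
  set S : Module.End K V := Algebra.lsmul K K V (Φ.switchingElement V) with hSdef
  have hS : ∀ r, S (L.v r) = ((a 0 / b 0) * (b r / a r)) • L.v r := fun r => by
    simp only [hSdef, LeonardSystem.switchingElement, map_sum, map_smul, LinearMap.sum_apply,
      LinearMap.smul_apply, hv, Φ.firstSplit_eq hT hθ hθs hw, Φ.secondSplit_eq hT hθ hθs hw,
      L.prod_split_div_prod_split]
    rw [Finset.sum_eq_single r]
    · simp [ha, hb]
    · intro j _ hj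
      simp [Ne.symm hj]
    · simp
  have hSw : S (L.w 0) = (a 0 / b 0) • L.w (Fin.last d) := L.apply_w_zero hS fun _ => rfl
  have hle : (∃ c : K, X = c • Φ.switchingElement V) →
      (actOnSeq X (Φ.flag V .zero) ≤ Φ.flag V .zero ∧
        actOnSeq X (Φ.flag V .D) ≤ Φ.flag V .D ∧
        actOnSeq X (Φ.flag V .zeroStar) ≤ Φ.flag V .DStar) := by
    rintro ⟨c, rfl⟩
    have hcS : ∀ x, Algebra.lsmul K K V (c • Φ.switchingElement V) x = c • S x := fun x => by
      rw [map_smul, LinearMap.smul_apply]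
    refine ⟨fun i => ?_, fun i => ?_, fun i => ?_⟩
    · rw [actOnSeq, flag_zero, Submodule.map_le_iff_le_comap]
      intro x hx
      rw [L.v.mem_iSup_span_iff] at hx
      rw [Submodule.mem_comap, hcS, L.v.mem_iSup_span_iff]
      intro j hj
      rw [map_smul, Finsupp.smul_apply, L.v.repr_diagonal_apply hS, hx j hj, mul_zero, smul_zero]
    · rw [actOnSeq, flag_D, Submodule.map_le_iff_le_comap]
      intro x hx
      rw [Module.Basis.mem_iSup_span_iff] at hx
      rw [Submodule.mem_comap, hcS, Module.Basis.mem_iSup_span_iff]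
      intro j hj
      have hxj := hx j hj
      simp only [LeonardBases.reverseV, Module.Basis.repr_reindex_apply] at hxj ⊢
      rw [map_smul, Finsupp.smul_apply, L.v.repr_diagonal_apply hS, hxj, mul_zero, smul_zero]
    · rw [actOnSeq, flag_zeroStar, flag_DStar, Submodule.map_le_iff_le_comap]
      intro x hx
      rw [L.w.mem_iSup_span_iff] at hx
      rw [Submodule.mem_comap, hcS, Module.Basis.mem_iSup_span_iff]
      intro j hj
      rw [map_smul, Finsupp.smul_apply, L.w_repr_apply_eq_zero hS hSw hx j hj, smul_zero]
  refine ⟨⟨hle, ?_⟩, fun h => ?_⟩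
  · rintro ⟨h0, hD, hs⟩
    have hX0 : ∀ r j, r < j → L.v.repr (Algebra.lsmul K K V X (L.v r)) j = 0 := fun r j hj => by
      have := h0 r
      rw [actOnSeq, flag_zero, Submodule.map_le_iff_le_comap] at this
      have := this ((L.v.mem_iSup_span_iff r (L.v r)).2 fun j hj => by simp [hj.ne])
      exact (L.v.mem_iSup_span_iff r _).1 this j hj
    have hXD : ∀ r j, j < r → L.v.repr (Algebra.lsmul K K V X (L.v r)) j = 0 := fun r j hj => by
      have := hD r.rev
      rw [actOnSeq, flag_D, Submodule.map_le_iff_le_comap] at this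
      have hmem := this (x := L.reverseV.v r.rev)
        ((Module.Basis.mem_iSup_span_iff _ _ _).2 fun j hj => by simp [hj.ne])
      have := (Module.Basis.mem_iSup_span_iff _ _ _).1 hmem j.rev (Fin.rev_lt_rev.2 hj)
      simpa [LeonardBases.reverseV] using this
    -- Only the `0`-th component of `X[0^*] ⊆ [D^*]` is needed.
    have hXw : ∀ j, j ≠ Fin.last d → L.w.repr (Algebra.lsmul K K V X (L.w 0)) j = 0 :=
      fun j hj => by
      have := hs 0
      rw [actOnSeq, flag_zeroStar, flag_DStar, Submodule.map_le_iff_le_comap] at this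
      have hmem := this (x := L.w 0)
        ((Module.Basis.mem_iSup_span_iff _ _ _).2 fun j hj => by simp [hj.ne])
      have := (Module.Basis.mem_iSup_span_iff _ _ _).1 hmem j.rev (by
        rw [Fin.pos_iff_ne_zero]
        exact fun h => hj (by rw [← Fin.rev_rev j, h, Fin.rev_zero]))
      simpa [LeonardBases.reverseW] using this
    obtain ⟨c, hc⟩ := L.eq_smul_of_flag_le hc hS (fun _ => rfl) hX0 hXD hXw
    exact ⟨c, hinj (by rw [hc, map_smul])⟩
  · obtain ⟨h0, hD, hs⟩ := hle h
    obtain ⟨c, rfl⟩ := h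
    have hc0 : c ≠ 0 := fun h => hX (by rw [h, zero_smul])
    -- All diagonal entries of `S` in `v` are nonzero, because every `a_r` and `b_r` is.
    have hker : Function.Injective (Algebra.lsmul K K V (c • Φ.switchingElement V)) := by
      refine (injective_iff_map_eq_zero _).2 fun x hx => L.v.ext_elem fun i => ?_
      rw [map_smul, LinearMap.smul_apply, smul_eq_zero, or_iff_right hc0] at hx
      have := L.v.repr_diagonal_apply hS x i
      rw [← hSdef] at hx
      rw [hx] at this
      simpa [hc, div_ne_zero (hb0 i) (ha0 i), ha, hb, ha0, hb0] using this.symm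
    have hrank : ∀ W : Submodule K V, Module.finrank K
        (W.map (Algebra.lsmul K K V (c • Φ.switchingElement V) : V →ₗ[K] V)) =
          Module.finrank K W := fun W => 
            (LinearEquiv.finrank_eq (Submodule.equivMapOfInjective _ hker W)).symm
    refine ⟨funext fun i => ?_, funext fun i => ?_, funext fun i => ?_⟩
    · refine Submodule.eq_of_le_of_finrank_eq (h0 i) ?_
      rw [actOnSeq, hrank]
    · refine Submodule.eq_of_le_of_finrank_eq (hD i) ?_
      rw [actOnSeq, hrank]
    · refine Submodule.eq_of_le_of_finrank_eq (hs i) ?_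
      rw [actOnSeq, hrank, flag_zeroStar, flag_DStar, Module.Basis.finrank_iSup_span,
        Module.Basis.finrank_iSup_span]
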